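/- Let $d\ge 1$, let $\Omega\subset\mathbb R^d$ be a nonempty open bounded convex polytope, let $\Gamma_D\subseteq\partial\Omega$ be measurable with positive surface measure, $\Gamma_N=\partial\Omega\setminus\Gamma_D$, and $V=\{v\in[H^1(\Omega)]^d : v=0 \text{ on } \Gamma_D\}$. Let $\rho>0$, $\alpha\in(0,1)$, $T>0$, let $\hat D$ be a piecewise constant symmetric positive definite fourth order tensor field on $\Omega$, $\varepsilon(v)=\frac12(\nabla v+\nabla v^{\mathsf T})$, $a(u,v)=\int_\Omega \hat D\varepsilon(u):\varepsilon(v)\,dx$, and $$I^{1-\alpha}w(t)=\frac1{\Gamma(1-\alpha)}\int_0^t (t-s)^{-\alpha}w(s)\,ds .$$ Let $f\in W^3_1(0,T;[L_2(\Omega)]^d)\cap H^2(0,T;[H^2(\Omega)]^d)$, let $g_N(t)\in[L_2(\Gamma_N)]^d$ for each $t$, and let $w:[0,T]\to V\cap[H^2(\Omega)]^d$ solve $$(\rho\dot w(t),v)_{L_2(\Omega)}+a(I^{1-\alpha}w(t),v)=(f(t),v)_{L_2(\Omega)}+(g_N(t),v)_{L_2(\Gamma_N)}\qquad\text{for all }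 v\in V,\ t\in(0,T].$$ (i) If $w\in C^1([0,T];[H^2(\Omega)]^d)$ (so that $w(0),\dot w(0)\in[H^2(\Omega)]^d$) and $w(0)=0$, then there is a constant $C>0$, independent of $\Delta t$, such that for every time step $\Delta t\in(0,T]$ (in particular for $\Delta t=T/N$), with $t_0=0$ and $t_1=\Delta t$, $$\Big\|\frac{w(t_1)-w(t_0)}{\Delta t}-\frac{\dot w(t_1)+\dot w(t_0)}2\Big\|_{L_2(\Omega)}\le C\,\Delta t^{2-\alpha}.$$ (ii) If moreover $\dot w(0)=0$ and $w\in C^2([0,T];[H^2(\Omega)]^d)$, then there is a constant $C>0$, independent of $\Delta t$, such that for every $\Delta t\in(0,T]$ this norm is at most $C\,\Delta t^2$. -/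

import Mathlib

open MeasureTheory Set Filter Topology
open scoped ContDiff ENNReal

namespace FracVisco

noncomputable section

/-- The Euclidean space `ℝ^d`. -/
abbrev E (d : ℕ) : Type := EuclideanSpace ℝ (Fin d)

/-- The `j`-th coordinate vector of `ℝ^d`. -/
abbrev e {d : ℕ} (j : Fin d) : E d := EuclideanSpace.single j (1 : ℝ)

/-- The space `[L_2(Ω)]^d` with its usual norm and inner product. -/
abbrev L2 {d : ℕ} (Ω : Set (E d)) : Type := Lp (E d) 2 (volume.restrict Ω)

/-! ### Sobolev spaces in space -/

/-- `v` is the weak partial derivative `∂_j u` on `Ω`. -/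
def HasWeakPartial {d : ℕ} (Ω : Set (E d)) (j : Fin d) (u v : L2 Ω) : Prop :=
  ∀ φ : E d → ℝ, ContDiff ℝ ∞ φ → HasCompactSupport φ → tsupport φ ⊆ Ω →
    ∫ x in Ω, (fderiv ℝ φ x (e j)) • u x = - ∫ x in Ω, φ x • v x

/-- A test function (or one of its derivatives) times an `L_2` function, integrated, as a
continuous linear map of the `L_2` function. -/
theorem exists_clm_integral_smul {d : ℕ} (Ω : Set (E d)) (φ : E d → ℝ) (hφ : Continuous φ)
    (hc : HasCompactSupport φ) :
    ∃ L : L2 Ω →L[ℝ] E d, ∀ u : L2 Ω, L u = ∫ x in Ω, φ x • u x := by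
  have hm : MemLp φ 2 (volume.restrict Ω) := (hφ.memLp_of_hasCompactSupport hc).restrict Ω
  refine ⟨(ContinuousLinearMap.lsmul ℝ ℝ).lpPairing (volume.restrict Ω) 2 2 (hm.toLp φ), ?_⟩
  intro u
  rw [ContinuousLinearMap.lpPairing_eq_integral]
  refine integral_congr_ae ?_
  filter_upwards [hm.coeFn_toLp] with x hx
  simp [hx]

theorem isClosed_hasWeakPartial {d : ℕ} (Ω : Set (E d)) (j : Fin d) {X : Type*}
    [TopologicalSpace X] {u v : X → L2 Ω} (hu : Continuous u) (hv : Continuous v) :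
    IsClosed {x : X | HasWeakPartial Ω j (u x) (v x)} := by
  simp only [HasWeakPartial, Set.ofPred_forall]
  refine isClosed_iInter fun φ => isClosed_iInter fun hφ => isClosed_iInter fun hc =>
    isClosed_iInter fun _ => ?_
  obtain ⟨A, hA⟩ := exists_clm_integral_smul Ω φ hφ.continuous hc
  obtain ⟨B, hB⟩ := exists_clm_integral_smul Ω (fun x => fderiv ℝ φ x (e j))
    ((hφ.continuous_fderiv (by simp)).clm_apply continuous_const) (hc.fderiv_apply ℝ (e j))
  simp only [← hA, ← hB]
  exact isClosed_eq (B.continuous.comp hu) (A.continuous.comp hv).neg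

theorem HasWeakPartial.zero {d : ℕ} (Ω : Set (E d)) (j : Fin d) :
    HasWeakPartial Ω j 0 0 := by
  intro φ hφ hc _
  obtain ⟨A, hA⟩ := exists_clm_integral_smul Ω φ hφ.continuous hc
  obtain ⟨B, hB⟩ := exists_clm_integral_smul Ω (fun x => fderiv ℝ φ x (e j))
    ((hφ.continuous_fderiv (by simp)).clm_apply continuous_const) (hc.fderiv_apply ℝ (e j))
  rw [← hA, ← hB]
  simp

theorem HasWeakPartial.add {d : ℕ} {Ω : Set (E d)} {j : Fin d} {u v u' v' : L2 Ω}
    (h : HasWeakPartial Ω j u v) (h' : HasWeakPartial Ω j u' v') :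
    HasWeakPartial Ω j (u + u') (v + v') := by
  intro φ hφ hc hs
  have h1 := h φ hφ hc hs
  have h2 := h' φ hφ hc hs
  obtain ⟨A, hA⟩ := exists_clm_integral_smul Ω φ hφ.continuous hc
  obtain ⟨B, hB⟩ := exists_clm_integral_smul Ω (fun x => fderiv ℝ φ x (e j))
    ((hφ.continuous_fderiv (by simp)).clm_apply continuous_const) (hc.fderiv_apply ℝ (e j))
  rw [← hA, ← hB] at h1 h2 ⊢
  rw [map_add, map_add, h1, h2, neg_add]

theorem HasWeakPartial.smul {d : ℕ} {Ω : Set (E d)} {j : Fin d} {u v : L2 Ω} (c : ℝ)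
    (h : HasWeakPartial Ω j u v) : HasWeakPartial Ω j (c • u) (c • v) := by
  intro φ hφ hc hs
  have h1 := h φ hφ hc hs
  obtain ⟨A, hA⟩ := exists_clm_integral_smul Ω φ hφ.continuous hc
  obtain ⟨B, hB⟩ := exists_clm_integral_smul Ω (fun x => fderiv ℝ φ x (e j))
    ((hφ.continuous_fderiv (by simp)).clm_apply continuous_const) (hc.fderiv_apply ℝ (e j))
  rw [← hA, ← hB] at h1 ⊢
  rw [map_smul, map_smul, h1, smul_neg]

/-- The Hilbert space `[H^1(Ω)]^d`: a function together with its weak first partial derivatives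
`∂_j u`, with norm `(‖u‖² + ∑_j ‖∂_j u‖²)^{1/2}`. -/
def H1 {d : ℕ} (Ω : Set (E d)) : Submodule ℝ (PiLp 2 (fun _ : Unit ⊕ Fin d => L2 Ω)) where
  carrier := {p | ∀ j, HasWeakPartial Ω j (p (Sum.inl ())) (p (Sum.inr j))}
  add_mem' := fun hp hq j => (hp j).add (hq j)
  zero_mem' := fun j => HasWeakPartial.zero Ω j
  smul_mem' := fun c _ hp j => (hp j).smul c

/-- The Hilbert space `[H^2(Ω)]^d`: a function together with its weak partial derivatives `∂_j u`
and `∂_k ∂_j u`, with norm `(‖u‖² + ∑_j ‖∂_j u‖² + ∑_{j,k} ‖∂_k ∂_j u‖²)^{1/2}`. -/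
def H2 {d : ℕ} (Ω : Set (E d)) :
    Submodule ℝ (PiLp 2 (fun _ : Unit ⊕ (Fin d ⊕ (Fin d × Fin d)) => L2 Ω)) where
  carrier := {p | (∀ j, HasWeakPartial Ω j (p (Sum.inl ())) (p (Sum.inr (Sum.inl j)))) ∧
    ∀ j k, HasWeakPartial Ω k (p (Sum.inr (Sum.inl j))) (p (Sum.inr (Sum.inr (j, k))))}
  add_mem' := fun hp hq => ⟨fun j => (hp.1 j).add (hq.1 j), fun j k => (hp.2 j k).add (hq.2 j k)⟩
  zero_mem' := ⟨fun j => HasWeakPartial.zero Ω j, fun _ k => HasWeakPartial.zero Ω k⟩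
  smul_mem' := fun c _ hp => ⟨fun j => (hp.1 j).smul c, fun j k => (hp.2 j k).smul c⟩

instance {d : ℕ} (Ω : Set (E d)) : CompleteSpace (H2 Ω) := by
  refine completeSpace_coe_iff_isComplete.2 (IsClosed.isComplete ?_)
  change IsClosed (H2 Ω : Set (PiLp 2 (fun _ : Unit ⊕ (Fin d ⊕ (Fin d × Fin d)) => L2 Ω)))
  have : (H2 Ω : Set (PiLp 2 (fun _ : Unit ⊕ (Fin d ⊕ (Fin d × Fin d)) => L2 Ω))) =
      (⋂ j, {p | HasWeakPartial Ω j (p (Sum.inl ())) (p (Sum.inr (Sum.inl j)))}) ∩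
      ⋂ j, ⋂ k, {p | HasWeakPartial Ω k (p (Sum.inr (Sum.inl j)))
        (p (Sum.inr (Sum.inr (j, k))))} := by
    ext p
    simp [H2]
  rw [this]
  refine IsClosed.inter (isClosed_iInter fun j => ?_)
    (isClosed_iInter fun j => isClosed_iInter fun k => ?_)
  · exact isClosed_hasWeakPartial Ω j (by fun_prop) (by fun_prop)
  · exact isClosed_hasWeakPartial Ω k (by fun_prop) (by fun_prop)

/-- The underlying `L_2` function of an `H^1` function. -/
def valH1 {d : ℕ} {Ω : Set (E d)} (u : H1 Ω) : L2 Ω := u.1 (Sum.inl ())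

/-- The partial derivative `∂_j u` of an `H^1` function. -/
def gradH1 {d : ℕ} {Ω : Set (E d)} (u : H1 Ω) (j : Fin d) : L2 Ω := u.1 (Sum.inr j)

/-- The underlying `L_2` function of an `H^2` function. -/
def valH2 {d : ℕ} {Ω : Set (E d)} (u : H2 Ω) : L2 Ω := u.1 (Sum.inl ())

/-- The inclusion of `[H^2(Ω)]^d` in `[H^1(Ω)]^d`. -/
def toH1 {d : ℕ} {Ω : Set (E d)} (u : H2 Ω) : H1 Ω :=
  ⟨WithLp.toLp 2 (Sum.elim (fun _ => u.1 (Sum.inl ())) (fun j => u.1 (Sum.inr (Sum.inl j)))),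
    fun j => u.2.1 j⟩

/-! ### Sobolev spaces in time -/

/-- `f ∈ W^k_p(0,T;X)`: `f` has weak time derivatives up to order `k` in `L_p(0,T;X)`
(`g i` is the `i`-th one). -/
def MemSobolevTime {X : Type*} [NormedAddCommGroup X] [NormedSpace ℝ X]
    (k : ℕ) (p : ℝ≥0∞) (T : ℝ) (f : ℝ → X) : Prop :=
  ∃ g : ℕ → ℝ → X, g 0 = f ∧
    (∀ i ≤ k, MemLp (g i) p (volume.restrict (Ioo 0 T))) ∧
    ∀ i < k, ∀ φ : ℝ → ℝ, ContDiff ℝ ∞ φ → HasCompactSupport φ → tsupport φ ⊆ Ioo 0 T →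
      ∫ t in Ioo 0 T, deriv φ t • g i t = - ∫ t in Ioo 0 T, φ t • g (i + 1) t

/-- The Riemann–Liouville fractional integral of order `a` based at `0`. -/
def fracIntegral {X : Type*} [NormedAddCommGroup X] [NormedSpace ℝ X]
    (a : ℝ) (u : ℝ → X) (t : ℝ) : X :=
  (Real.Gamma a)⁻¹ • ∫ s in (0 : ℝ)..t, (t - s) ^ (a - 1) • u s

/-! ### Domain, boundary values and elasticity tensor -/

/-- `Ω` is a (nonempty) open bounded convex polytope. -/
def IsConvexPolytope {d : ℕ} (Ω : Set (E d)) : Prop :=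
  Ω.Nonempty ∧ ∃ P : Set (E d), P.Finite ∧ Ω = interior (convexHull ℝ P)

/-- The surface measure on the boundary of `Ω`. -/
abbrev surface {d : ℕ} (Ω : Set (E d)) : Measure (E d) :=
  (Measure.euclideanHausdorffMeasure (d - 1)).restrict (frontier Ω)

/-- `γ` is the boundary trace of `v ∈ [H^1(Ω)]^d`: some smooth functions tend to `v` in `H^1(Ω)`
while their boundary values tend to `γ` in `L_2(∂Ω)`. -/
def IsTrace {d : ℕ} {Ω : Set (E d)} (v : H1 Ω) (γ : Lp (E d) 2 (surface Ω)) : Prop :=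
  ∃ φ : ℕ → E d → E d, (∀ n, ContDiff ℝ ∞ (φ n)) ∧
    Tendsto (fun n => eLpNorm (fun x => φ n x - valH1 v x) 2 (volume.restrict Ω)) atTop (𝓝 0) ∧
    (∀ j, Tendsto (fun n => eLpNorm (fun x => fderiv ℝ (φ n) x (e j) - gradH1 v j x) 2
      (volume.restrict Ω)) atTop (𝓝 0)) ∧
    Tendsto (fun n => eLpNorm (fun x => φ n x - γ x) 2 (surface Ω)) atTop (𝓝 0)

/-- `v` has the trace `γ`, and `γ = 0` on `ΓD`; so `v` belongs to the space
`V = {v ∈ [H^1(Ω)]^d | v = 0 on ΓD}`. -/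
def IsTraceV {d : ℕ} {Ω : Set (E d)} (ΓD : Set (E d)) (v : H1 Ω) (γ : Lp (E d) 2 (surface Ω)) :
    Prop :=
  IsTrace v γ ∧ ∀ᵐ x ∂((surface Ω).restrict ΓD), γ x = 0

/-- Fourth order tensors `C_{ijkl}`. -/
abbrev Tensor4 (d : ℕ) : Type := Fin d → Fin d → Fin d → Fin d → ℝ

/-- Symmetric positive definite fourth order tensors: `C` has the symmetries
`C_{ijkl} = C_{jikl} = C_{klij}`, and `Cξ : ξ > 0` for symmetric `ξ ≠ 0`. -/
structure IsSPD {d : ℕ} (C : Tensor4 d) : Prop where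
  minor : ∀ i j k l, C i j k l = C j i k l
  major : ∀ i j k l, C i j k l = C k l i j
  pos : ∀ ξ : Fin d → Fin d → ℝ, (∀ i j, ξ i j = ξ j i) → ξ ≠ 0 →
    0 < ∑ i, ∑ j, ∑ k, ∑ l, C i j k l * ξ k l * ξ i j

/-- `D` is a symmetric positive definite fourth order tensor field on `Ω` that is piecewise
constant: constant on each of finitely many disjoint open sets that fill `Ω` up to a null set. -/
def IsPiecewiseSPD {d : ℕ} (Ω : Set (E d)) (D : E d → Tensor4 d) : Prop :=
  ∃ (M : ℕ) (U : Fin M → Set (E d)) (C : Fin M → Tensor4 d),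
    (∀ m, IsOpen (U m) ∧ U m ⊆ Ω) ∧ Pairwise (fun m n => Disjoint (U m) (U n)) ∧
    volume (Ω \ ⋃ m, U m) = 0 ∧ ∀ m, IsSPD (C m) ∧ ∀ x ∈ U m, D x = C m

/-- The strain `ε_{ij}(v) = (∂_j v_i + ∂_i v_j) / 2` at `x`. -/
def strain {d : ℕ} {Ω : Set (E d)} (v : H1 Ω) (i j : Fin d) (x : E d) : ℝ :=
  (gradH1 v j x i + gradH1 v i x j) / 2

/-- The bilinear form `a(u,v) = ∫_Ω D ε(u) : ε(v)`. -/
def bilin {d : ℕ} {Ω : Set (E d)} (D : E d → Tensor4 d) (u v : H1 Ω) : ℝ :=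
  ∫ x in Ω, ∑ i, ∑ j, ∑ k, ∑ l, D x i j k l * strain u k l x * strain v i j x

/-- `w : [0,T] → [H^2(Ω)]^d ∩ V` solves the viscoelastic model problem on `[0,T]` with Dirichlet
boundary `ΓD` and Neumann boundary `ΓN = ∂Ω \ ΓD`, in the weak form
`(ρ ẇ(t), v) + a(I^{1-α} w(t), v) = (f(t), v) + (gN(t), v)_{L_2(ΓN)}` for `v ∈ V`, `0 < t ≤ T`. -/
structure IsSolution {d : ℕ} {Ω : Set (E d)} (ΓD : Set (E d)) (D : E d → Tensor4 d) (ρ α T : ℝ)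
    (f : ℝ → H2 Ω)
    (gN : ℝ → Lp (E d) 2 ((Measure.euclideanHausdorffMeasure (d - 1)).restrict
      (frontier Ω \ ΓD)))
    (w : ℝ → H2 Ω) : Prop where
  dirichlet : ∀ t ∈ Icc 0 T, ∃ γ, IsTraceV ΓD (toH1 (w t)) γ
  weak : ∀ t ∈ Ioc 0 T, ∀ (v : H1 Ω) (γ : Lp (E d) 2 (surface Ω)), IsTraceV ΓD v γ →
    inner ℝ (ρ • valH2 (derivWithin w (Icc 0 T) t)) (valH1 v) +
        bilin D (toH1 (fracIntegral (1 - α) w t)) v =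
      inner ℝ (valH2 (f t)) (valH1 v) +
        ∫ x in frontier Ω \ ΓD, inner ℝ (gN t x) (γ x)
          ∂(Measure.euclideanHausdorffMeasure (d - 1))

/-- The Crank–Nicolson truncation error of the first time step,
`(w(τ) - w(0)) / τ - (ẇ(τ) + ẇ(0)) / 2` with `τ = Δt`; derivatives at the ends of `[0,T]` are
one-sided. -/
def truncationError {d : ℕ} {Ω : Set (E d)} (T : ℝ) (w : ℝ → H2 Ω) (τ : ℝ) : L2 Ω :=
  valH2 (τ⁻¹ • (w τ - w 0) -
    (2 : ℝ)⁻¹ • (derivWithin w (Icc 0 T) τ + derivWithin w (Icc 0 T) 0))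

end

end FracVisco

open FracVisco

/-!
Since `g_N` enters only through a boundary integral, testing the weak form with functions `φ e_i`
supported inside one piece of constancy of the tensor field removes all boundary terms. As
`w(t) ∈ H^2`, integration by parts on that piece shows that the residual `ρ ẇ(t) - f(t)` is
almost everywhere the divergence of the stress of `I^{1-α} w(t)`, a fixed finite combination of
second derivatives (`ae_eq_div_stress`). The pieces fill `Ω` up to a null set, hence
`‖ρ ẇ(t) - f(t)‖_{L_2} ≤ A ‖I^{1-α} w(t)‖_{H^2}` with `A` independent of `t`
(`exists_norm_le_of_weak_eq`, `IsSolution.exists_norm_residual_le`).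

If `‖w(t)‖ ≤ M t^q`, then `‖I^{1-α} w(t)‖ ≤ M' t^{q+1-α}` (`norm_fracIntegral_le`). So `ρ ẇ` is `f`
plus a remainder of size `t^{q+1-α}`. By the du Bois-Reymond lemma, `f ∈ W^3_1(0,T;L_2)` has a
`C^2` representative `F` (`MemSobolevTime.exists_C2`); it equals `f` only almost everywhere, but
`ρ ẇ - F` is continuous, so the bound on the remainder passes to `F` at every time. The truncation
error is the error of the trapezoidal rule for `ẇ` on `[0,τ]`, divided by `τ`: the `C^2` part
contributes `τ^2` and the remainder, estimated in absolute value, contributes `τ^{q+1-α}`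
(`exists_norm_crankNicolson_le`).

Finally `w(0) = 0` and `w ∈ C^1` give `q = 1`, and `w(0) = ẇ(0) = 0` and `w ∈ C^2` give `q = 2`, for
which `τ^{3-α} ≤ T^{1-α} τ^2`.
-/

/-! ### Weak derivatives on an interval -/

section Time

variable {X : Type*} [NormedAddCommGroup X] [NormedSpace ℝ X]

theorem integrable_continuous_smul {T : ℝ} {φ : ℝ → ℝ} (hφ : Continuous φ) {G : ℝ → X}
    (hG : IntegrableOn G (Ioo 0 T)) :
    Integrable (fun t => φ t • G t) (volume.restrict (Ioo 0 T)) := by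
  obtain ⟨C, hC⟩ := isCompact_Icc.exists_bound_of_continuousOn (hφ.continuousOn (s := Icc 0 T))
  refine hG.bdd_smul C hφ.aestronglyMeasurable ?_
  filter_upwards [ae_restrict_mem measurableSet_Ioo] with t ht
    using hC t (Ioo_subset_Icc_self ht)

variable [CompleteSpace X]

/-- Integration by parts against the primitive of a function that is merely integrable. -/
theorem integral_deriv_smul_primitive {T : ℝ} {h : ℝ → X} (hh : IntegrableOn h (Ioo 0 T))
    {φ : ℝ → ℝ} (hφ : ContDiff ℝ ∞ φ) (hφT : φ T = 0) :
    ∫ t in Ioo 0 T, deriv φ t • ∫ s in (0 : ℝ)..t, h s = - ∫ t in Ioo 0 T, φ t • h t := by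
  have hφ1 : ContDiff ℝ 1 φ := hφ.of_le (by exact_mod_cast le_top)
  have hc : Continuous (deriv φ) := hφ1.continuous_deriv le_rfl
  have hi : Integrable (deriv φ) (volume.restrict (Ioo 0 T)) :=
    (hc.integrableOn_Icc (a := 0) (b := T)).mono_set Ioo_subset_Icc_self
  -- Fubini on the triangle `s < t`
  have hk : Integrable (Function.uncurry fun t s : ℝ =>
      (Iio t).indicator (fun s => deriv φ t • h s) s)
      ((volume.restrict (Ioo 0 T)).prod (volume.restrict (Ioo 0 T))) := by
    have := (hi.smul_prod hh).indicator
      (measurableSet_lt (measurable_snd (α := ℝ) (β := ℝ)) measurable_fst)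
    refine this.congr (Eventually.of_forall fun p => ?_)
    simp [Function.uncurry, indicator]
  have hl : ∫ t in Ioo 0 T, deriv φ t • ∫ s in (0 : ℝ)..t, h s =
      ∫ t in Ioo 0 T, ∫ s in Ioo 0 T, (Iio t).indicator (fun s => deriv φ t • h s) s := by
    refine setIntegral_congr_fun measurableSet_Ioo fun t ht => ?_
    rw [setIntegral_indicator measurableSet_Iio, integral_smul,
      intervalIntegral.integral_of_le ht.1.le, integral_Ioc_eq_integral_Ioo]
    congr 3
    ext s
    simp only [mem_Ioo, mem_inter_iff, mem_Iio]
    exact ⟨fun hs => ⟨⟨hs.1, hs.2.trans ht.2⟩, hs.2⟩, fun hs => ⟨hs.1.1, hs.2⟩⟩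
  rw [hl, integral_integral_swap hk, ← integral_neg]
  refine setIntegral_congr_fun measurableSet_Ioo fun s hs => ?_
  have h1 : ∀ t, (Iio t).indicator (fun s => deriv φ t • h s) s =
      ((Ioi s).indicator (deriv φ) t) • h s := by
    intro t
    by_cases hst : s < t <;> simp [indicator, hst]
  simp only [h1]
  rw [integral_smul_const, setIntegral_indicator measurableSet_Ioi]
  have h2 : Ioo 0 T ∩ Ioi s = Ioo s T := by
    ext t
    simp only [mem_Ioo, mem_inter_iff, mem_Ioi]
    exact ⟨fun ht => ⟨ht.2, ht.1.2⟩, fun ht => ⟨⟨hs.1.trans ht.1, ht.2⟩, ht.1⟩⟩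
  rw [h2, ← integral_Ioc_eq_integral_Ioo, ← intervalIntegral.integral_of_le hs.2.le,
    intervalIntegral.integral_deriv_eq_sub (fun x _ => (hφ1.differentiable (by simp)) x)
      (hc.intervalIntegrable _ _), hφT, zero_sub, neg_smul]

/-- A smooth function of integral zero, compactly supported in an interval, is the derivative of
another such function. -/
theorem exists_primitive_of_integral_eq_zero {T : ℝ} {θ : ℝ → ℝ} (hθ : ContDiff ℝ ∞ θ)
    (hs : HasCompactSupport θ) (hT : tsupport θ ⊆ Ioo 0 T) (h0 : ∫ t, θ t = 0) :
    ∃ χ : ℝ → ℝ, ContDiff ℝ ∞ χ ∧ HasCompactSupport χ ∧ tsupport χ ⊆ Ioo 0 T ∧ deriv χ = θ := by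
  rcases (tsupport θ).eq_empty_or_nonempty with he | hne
  · have : θ = 0 := tsupport_eq_empty_iff.1 he
    exact ⟨0, contDiff_const, HasCompactSupport.zero, by simp, by simp [this]⟩
  obtain ⟨x, hx, hxm⟩ := hs.isCompact.exists_isLeast hne
  obtain ⟨y, hy, hym⟩ := hs.isCompact.exists_isGreatest hne
  -- the base point lies strictly to the left of the support, where the primitive vanishes
  obtain ⟨a, ha0, hax⟩ := exists_between (hT hx).1
  have hsupp : Function.support θ ⊆ Ioc a y := fun t ht =>
    ⟨hax.trans_le (hxm (subset_tsupport _ ht)), hym (subset_tsupport _ ht)⟩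
  have hd : ∀ t, HasDerivAt (fun t => ∫ s in a..t, θ s) (θ t) t := fun t =>
    intervalIntegral.integral_hasDerivAt_right (hθ.continuous.intervalIntegrable _ _)
      (hθ.continuous.stronglyMeasurableAtFilter _ _) hθ.continuous.continuousAt
  have hd' : deriv (fun t => ∫ s in a..t, θ s) = θ := funext fun t => (hd t).deriv
  have hχ : Function.support (fun t => ∫ s in a..t, θ s) ⊆ Icc a y := by
    intro t ht
    by_contra hn
    refine ht ?_
    simp only
    rcases not_and_or.1 hn with h | h
    · rw [not_le] at h
      refine intervalIntegral.integral_zero_ae (Eventually.of_forall fun s hs => ?_)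
      rw [uIoc_of_ge h.le] at hs
      by_contra hns
      exact absurd (hsupp hns).1 (not_lt.2 hs.2)
    · rw [not_le] at h
      rw [intervalIntegral.integral_eq_integral_of_support_subset
        (hsupp.trans (Ioc_subset_Ioc_right h.le)), h0]
  have hts : tsupport (fun t => ∫ s in a..t, θ s) ⊆ Icc a y := closure_minimal hχ isClosed_Icc
  refine ⟨fun t => ∫ s in a..t, θ s, ?_, ?_, ?_, hd'⟩
  · rw [contDiff_infty_iff_deriv]
    exact ⟨fun t => (hd t).differentiableAt, by rwa [hd']⟩
  · exact isCompact_Icc.of_isClosed_subset (isClosed_tsupport _) hts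
  · exact hts.trans fun t ht => ⟨ha0.trans_le ht.1, ht.2.trans_lt (hT hy).2⟩

/-- The du Bois-Reymond lemma: a function whose weak derivative vanishes is constant. -/
theorem exists_ae_eq_const_of_weak_deriv_zero {T : ℝ} (hT : 0 < T) {G : ℝ → X}
    (hG : IntegrableOn G (Ioo 0 T))
    (h : ∀ φ : ℝ → ℝ, ContDiff ℝ ∞ φ → HasCompactSupport φ → tsupport φ ⊆ Ioo 0 T →
      ∫ t in Ioo 0 T, deriv φ t • G t = 0) :
    ∃ c : X, ∀ᵐ t ∂(volume.restrict (Ioo 0 T)), G t = c := by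
  let b : ContDiffBump (T / 2) := ⟨T / 6, T / 4, by linarith, by linarith⟩
  set ψ : ℝ → ℝ := b.normed volume with hψ
  have hψ1 : ContDiff ℝ ∞ ψ := b.contDiff_normed
  have hψ2 : HasCompactSupport ψ := b.hasCompactSupport_normed
  have hψ3 : tsupport ψ ⊆ Ioo 0 T := by
    rw [hψ, b.tsupport_normed_eq, Real.closedBall_eq_Icc]
    intro t ht
    have : b.rOut = T / 4 := rfl
    rw [this] at ht
    exact ⟨by linarith [ht.1], by linarith [ht.2]⟩
  have hψ4 : ∫ t, ψ t = 1 := b.integral_normed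
  have hint : ∀ φ : ℝ → ℝ, Continuous φ →
      Integrable (fun t => φ t • G t) (volume.restrict (Ioo 0 T)) :=
    fun φ hφ => integrable_continuous_smul hφ hG
  set c : X := ∫ t in Ioo 0 T, ψ t • G t with hc
  refine ⟨c, ?_⟩
  have key := isOpen_Ioo.ae_eq_zero_of_integral_contDiff_smul_eq_zero
    (μ := volume.restrict (Ioo 0 T)) (f := fun t => G t - c) (U := Ioo 0 T)
    ((hG.sub (integrable_const c)).locallyIntegrable.locallyIntegrableOn _) ?_
  · filter_upwards [key, ae_restrict_mem measurableSet_Ioo] with t ht hm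
    exact sub_eq_zero.1 (ht hm)
  intro φ hφ1 hφ2 hφ3
  -- subtracting a multiple of `ψ` makes the mean of `φ` vanish
  have hz : ∀ φ : ℝ → ℝ, tsupport φ ⊆ Ioo 0 T → ∫ t in Ioo 0 T, φ t = ∫ t, φ t := fun φ hφ =>
    setIntegral_eq_integral_of_forall_compl_eq_zero fun t ht =>
      image_eq_zero_of_notMem_tsupport fun h' => ht (hφ h')
  set m : ℝ := ∫ t, φ t with hm
  have hi1 : Integrable φ := hφ1.continuous.integrable_of_hasCompactSupport hφ2
  have hi2 : Integrable ψ := hψ1.continuous.integrable_of_hasCompactSupport hψ2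
  have hts : tsupport (fun t => φ t - m * ψ t) ⊆ tsupport φ ∪ tsupport ψ :=
    closure_minimal (fun t ht => by
      by_contra hn
      rw [mem_union, not_or] at hn
      exact ht (by simp [image_eq_zero_of_notMem_tsupport hn.1,
        image_eq_zero_of_notMem_tsupport hn.2]))
      ((isClosed_tsupport _).union (isClosed_tsupport _))
  obtain ⟨χ, hχ1, hχ2, hχ3, hχ4⟩ := exists_primitive_of_integral_eq_zero (T := T)
    (θ := fun t => φ t - m * ψ t) (hφ1.sub (contDiff_const.mul hψ1))
    ((hφ2.isCompact.union hψ2.isCompact).of_isClosed_subset (isClosed_tsupport _) hts)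
    (hts.trans (union_subset hφ3 hψ3))
    (by rw [integral_sub hi1 (hi2.const_mul m), integral_const_mul, hψ4]; simp [hm])
  have h1 := h χ hχ1 hχ2 hχ3
  rw [hχ4] at h1
  simp only [sub_smul, mul_smul] at h1
  rw [integral_sub (hint φ hφ1.continuous) (g := fun t => m • ψ t • G t)
    ((hint ψ hψ1.continuous).smul m), integral_smul,
    ← hc, sub_eq_zero] at h1
  simp only [smul_sub]
  rw [integral_sub (hint φ hφ1.continuous) (hi1.restrict.smul_const c), h1, integral_smul_const,
    hz φ hφ3, sub_self]

/-- A function with an integrable weak derivative is a primitive of it. -/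
theorem exists_ae_eq_const_add_primitive {T : ℝ} (hT : 0 < T) {g h : ℝ → X}
    (hg : IntegrableOn g (Ioo 0 T)) (hh : IntegrableOn h (Ioo 0 T))
    (hw : ∀ φ : ℝ → ℝ, ContDiff ℝ ∞ φ → HasCompactSupport φ → tsupport φ ⊆ Ioo 0 T →
      ∫ t in Ioo 0 T, deriv φ t • g t = - ∫ t in Ioo 0 T, φ t • h t) :
    ∃ c : X, ∀ᵐ t ∂(volume.restrict (Ioo 0 T)), g t = c + ∫ s in (0 : ℝ)..t, h s := by
  have hp : ContinuousOn (fun t => ∫ s in (0 : ℝ)..t, h s) (Icc 0 T) :=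
    intervalIntegral.continuousOn_primitive_interval
      (by rw [uIcc_of_le hT.le]; exact (integrableOn_Icc_iff_integrableOn_Ioo).2 hh) |>.mono
      (by rw [uIcc_of_le hT.le])
  have hpi : IntegrableOn (fun t => ∫ s in (0 : ℝ)..t, h s) (Ioo 0 T) :=
    hp.integrableOn_Icc.mono_set Ioo_subset_Icc_self
  obtain ⟨c, hc⟩ := exists_ae_eq_const_of_weak_deriv_zero hT (hg.sub hpi) fun φ h1 h2 h3 => by
    have hcd : Continuous (deriv φ) := h1.continuous_deriv (by exact_mod_cast le_top)
    simp only [Pi.sub_apply, smul_sub]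
    rw [integral_sub (integrable_continuous_smul hcd hg) (integrable_continuous_smul hcd hpi),
      hw φ h1 h2 h3,
      integral_deriv_smul_primitive hh h1
        (image_eq_zero_of_notMem_tsupport fun hm => lt_irrefl _ (h3 hm).2), sub_self]
  exact ⟨c, hc.mono fun t ht => sub_eq_iff_eq_add.1 ht⟩

end Time

/-! ### The trapezoidal rule -/

section Trapezoid

variable {X : Type*} [NormedAddCommGroup X] [NormedSpace ℝ X]

/-- The trapezoidal rule for a function with bounded second derivative, on an interval of length
`τ`, has an error of order `τ ^ 3`. -/
theorem norm_trapezoid_le {T B : ℝ} {Φ F F' F'' : ℝ → X} (hΦ : ∀ t, HasDerivAt Φ (F t) t)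
    (hF : ∀ t, HasDerivAt F (F' t) t) (hF' : ∀ t, HasDerivAt F' (F'' t) t)
    (hB : ∀ t ∈ Icc 0 T, ‖F'' t‖ ≤ B) {τ : ℝ} (hτ : τ ∈ Icc 0 T) :
    ‖Φ τ - Φ 0 - (τ / 2) • (F τ + F 0)‖ ≤ B * τ ^ 3 := by
  have hB0 : 0 ≤ B := (norm_nonneg _).trans (hB τ hτ)
  -- twice the derivative of the error in `τ` is the first-order Taylor remainder of `F` about `τ`,
  -- evaluated at `0`, up to sign
  have h1 : ∀ t ∈ Icc 0 τ, ‖F t - F 0 - t • F' t‖ ≤ B * τ ^ 2 := by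
    intro t ht
    have hd : ∀ s ∈ Icc 0 t, HasDerivWithinAt (fun s => F s - s • F' s) (-(s • F'' s))
        (Icc 0 t) s := by
      intro s _
      have := (hF s).sub ((hasDerivAt_id s).smul (hF' s))
      exact this.hasDerivWithinAt.congr_deriv (by simp)
    have hb : ∀ s ∈ Ico 0 t, ‖-(s • F'' s)‖ ≤ τ * B := by
      intro s hs
      rw [norm_neg, norm_smul, Real.norm_of_nonneg hs.1]
      exact mul_le_mul (hs.2.le.trans ht.2) (hB s ⟨hs.1, hs.2.le.trans (ht.2.trans hτ.2)⟩)
        (norm_nonneg _) hτ.1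
    have h := norm_image_sub_le_of_norm_deriv_le_segment' hd hb t ⟨ht.1, le_rfl⟩
    simp only [zero_smul, sub_zero] at h
    calc ‖F t - F 0 - t • F' t‖ = ‖F t - t • F' t - F 0‖ := by rw [sub_right_comm]
      _ ≤ τ * B * t := h
      _ ≤ τ * B * τ := mul_le_mul_of_nonneg_left ht.2 (mul_nonneg hτ.1 hB0)
      _ = B * τ ^ 2 := by ring
  have hd : ∀ s ∈ Icc 0 τ, HasDerivWithinAt (fun s => Φ s - (s / 2) • (F s + F 0))
      ((2 : ℝ)⁻¹ • (F s - F 0 - s • F' s)) (Icc 0 τ) s := by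
    intro s _
    have := (hΦ s).sub (((hasDerivAt_id s).div_const 2).smul ((hF s).add_const (F 0)))
    exact this.hasDerivWithinAt.congr_deriv (by simp only [id]; module)
  have hb : ∀ s ∈ Ico 0 τ, ‖(2 : ℝ)⁻¹ • (F s - F 0 - s • F' s)‖ ≤ B * τ ^ 2 := by
    intro s hs
    have := h1 s ⟨hs.1, hs.2.le⟩
    rw [norm_smul, Real.norm_of_nonneg (by norm_num)]
    linarith [norm_nonneg (F s - F 0 - s • F' s)]
  have h := norm_image_sub_le_of_norm_deriv_le_segment' hd hb τ ⟨hτ.1, le_rfl⟩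
  simp only [zero_div, zero_smul, sub_zero] at h
  rw [sub_right_comm]
  calc _ ≤ B * τ ^ 2 * τ := h
    _ = B * τ ^ 3 := by ring

variable [CompleteSpace X]

/-- A function whose weak derivative is almost everywhere equal to a continuous function `H` is
almost everywhere equal to a classical primitive of `H`. -/
theorem exists_hasDerivAt_of_weak_deriv {T : ℝ} (hT : 0 < T) {g h H : ℝ → X}
    (hg : IntegrableOn g (Ioo 0 T)) (hh : IntegrableOn h (Ioo 0 T))
    (hw : ∀ φ : ℝ → ℝ, ContDiff ℝ ∞ φ → HasCompactSupport φ → tsupport φ ⊆ Ioo 0 T →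
      ∫ t in Ioo 0 T, deriv φ t • g t = - ∫ t in Ioo 0 T, φ t • h t)
    (hH : Continuous H) (hhH : ∀ᵐ t ∂(volume.restrict (Ioo 0 T)), h t = H t) :
    ∃ G : ℝ → X, (∀ t, HasDerivAt G (H t) t) ∧
      ∀ᵐ t ∂(volume.restrict (Ioo 0 T)), g t = G t := by
  obtain ⟨c, hc⟩ := exists_ae_eq_const_add_primitive hT hg hh hw
  refine ⟨fun t => c + ∫ s in (0 : ℝ)..t, H s, fun t => ?_, ?_⟩
  · exact (intervalIntegral.integral_hasDerivAt_right (hH.intervalIntegrable _ _)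
      (hH.stronglyMeasurableAtFilter _ _) hH.continuousAt).const_add c
  · filter_upwards [hc, ae_restrict_mem measurableSet_Ioo] with t ht hm
    rw [ht, intervalIntegral.integral_of_le hm.1.le, intervalIntegral.integral_of_le hm.1.le,
      integral_Ioc_eq_integral_Ioo, integral_Ioc_eq_integral_Ioo]
    congr 1
    exact integral_congr_ae (ae_mono (Measure.restrict_mono_set _ (Ioo_subset_Ioo_right hm.2.le))
      hhH)

/-- A function in `W^3_1(0,T;X)` has a representative of class `C^2`. -/
theorem FracVisco.MemSobolevTime.exists_C2 {T : ℝ} (hT : 0 < T) {f : ℝ → X}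
    (hf : MemSobolevTime 3 1 T f) :
    ∃ F F' F'' : ℝ → X, (∀ t, HasDerivAt F (F' t) t) ∧ (∀ t, HasDerivAt F' (F'' t) t) ∧
      Continuous F'' ∧ ∀ᵐ t ∂(volume.restrict (Ioo 0 T)), f t = F t := by
  obtain ⟨g, hg0, hgi, hgw⟩ := hf
  have hi : ∀ i ≤ 3, IntegrableOn (g i) (Ioo 0 T) := fun i h => memLp_one_iff_integrable.1 (hgi i h)
  obtain ⟨c, hc⟩ := exists_ae_eq_const_add_primitive hT (hi 2 (by norm_num)) (hi 3 (by norm_num))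
    (hgw 2 (by norm_num))
  -- extending the third derivative by zero makes its primitive continuous on all of `ℝ`
  have hk : Integrable ((Ioo 0 T).indicator (g 3)) :=
    (hi 3 le_rfl).integrable_indicator measurableSet_Ioo
  have hH : Continuous (fun t => c + ∫ s in (0 : ℝ)..t, (Ioo 0 T).indicator (g 3) s) :=
    continuous_const.add (intervalIntegral.continuous_primitive
      (fun a b => hk.intervalIntegrable) 0)
  have h2 : ∀ᵐ t ∂(volume.restrict (Ioo 0 T)),
      g 2 t = c + ∫ s in (0 : ℝ)..t, (Ioo 0 T).indicator (g 3) s := by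
    filter_upwards [hc, ae_restrict_mem measurableSet_Ioo] with t ht hm
    rw [ht]
    congr 1
    refine intervalIntegral.integral_congr_ae (Eventually.of_forall fun s hs => ?_)
    rw [uIoc_of_le hm.1.le] at hs
    rw [indicator_of_mem (show s ∈ Ioo 0 T from ⟨hs.1, hs.2.trans_lt hm.2⟩)]
  obtain ⟨F', hF', h1⟩ := exists_hasDerivAt_of_weak_deriv hT (hi 1 (by norm_num))
    (hi 2 (by norm_num)) (hgw 1 (by norm_num)) hH h2
  obtain ⟨F, hF, h0⟩ := exists_hasDerivAt_of_weak_deriv hT (hi 0 (by norm_num))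
    (hi 1 (by norm_num)) (hgw 0 (by norm_num))
    (continuous_iff_continuousAt.2 fun t => (hF' t).continuousAt) h1
  exact ⟨F, F', _, hF, hF', hH, hg0 ▸ h0⟩

/-- The first-step error of the Crank-Nicolson scheme for `y` when `y'` is the sum of a function in
`W^3_1(0,T;X)` and a remainder of size `t ^ p`. -/
theorem exists_norm_crankNicolson_le {T K p : ℝ} (hT : 0 < T) (hp : 0 < p) (hK : 0 ≤ K)
    {y y' f : ℝ → X}
    (hy : ∀ t ∈ Icc 0 T, HasDerivWithinAt y (y' t) (Icc 0 T) t) (hy' : ContinuousOn y' (Icc 0 T))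
    (hf : MemSobolevTime 3 1 T f) (hR : ∀ t ∈ Ioc 0 T, ‖y' t - f t‖ ≤ K * t ^ p) :
    ∃ B : ℝ, 0 ≤ B ∧ ∀ τ ∈ Ioc 0 T,
      ‖τ⁻¹ • (y τ - y 0) - (2 : ℝ)⁻¹ • (y' τ + y' 0)‖ ≤ B * τ ^ 2 + 2 * K * τ ^ p := by
  obtain ⟨F, F', F'', hF, hF', hF'', hfF⟩ := hf.exists_C2 hT
  have hFc : Continuous F := continuous_iff_continuousAt.2 fun t => (hF t).continuousAt
  obtain ⟨B, hB⟩ := isCompact_Icc.exists_bound_of_continuousOn (hF''.continuousOn (s := Icc 0 T))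
  have hB0 : 0 ≤ B := (norm_nonneg _).trans (hB 0 ⟨le_rfl, hT.le⟩)
  set Φ : ℝ → X := fun t => ∫ s in (0 : ℝ)..t, F s
  have hΦ : ∀ t, HasDerivAt Φ (F t) t := fun t =>
    intervalIntegral.integral_hasDerivAt_right (hFc.intervalIntegrable _ _)
      (hFc.stronglyMeasurableAtFilter _ _) hFc.continuousAt
  -- `f` equals its representative almost everywhere only, but `y' - F` is continuous
  have hR' : ∀ t ∈ Icc 0 T, ‖y' t - F t‖ ≤ K * t ^ p := by
    have hc1 : ContinuousOn (fun t : ℝ => K * t ^ p) (Icc 0 T) :=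
      continuousOn_const.mul (Real.continuous_rpow_const hp.le).continuousOn
    have hc2 : ContinuousOn (fun t => ‖y' t - F t‖) (Icc 0 T) := (hy'.sub hFc.continuousOn).norm
    have h := Measure.eqOn_Icc_of_ae_eq (μ := volume) hT.ne
      (f := fun t => max (‖y' t - F t‖) (K * t ^ p)) (g := fun t => K * t ^ p) ?_
      (hc2.sup hc1) hc1
    · intro t ht
      exact max_eq_right_iff.1 (h ht)
    · rw [← restrict_Ioo_eq_restrict_Icc]
      filter_upwards [hfF, ae_restrict_mem measurableSet_Ioo] with t ht hm
      exact max_eq_right (ht ▸ hR t ⟨hm.1, hm.2.le⟩)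
  refine ⟨B, hB0, fun τ hτ => ?_⟩
  have hτ' : τ ∈ Icc 0 T := ⟨hτ.1.le, hτ.2⟩
  have hmono : ∀ t ∈ Icc 0 τ, ‖y' t - F t‖ ≤ K * τ ^ p := fun t ht =>
    (hR' t ⟨ht.1, ht.2.trans hτ.2⟩).trans
      (mul_le_mul_of_nonneg_left (Real.rpow_le_rpow ht.1 ht.2 hp.le) hK)
  -- `y - Φ` has the small derivative `y' - F`
  have h1 : ‖y τ - Φ τ - (y 0 - Φ 0)‖ ≤ K * τ ^ p * τ := by
    have := norm_image_sub_le_of_norm_deriv_le_segment' (f := fun t => y t - Φ t)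
      (f' := fun t => y' t - F t) (a := 0) (b := τ)
      (fun t ht => ((hy t ⟨ht.1, ht.2.trans hτ.2⟩).mono (Icc_subset_Icc_right hτ.2)).sub
        (hΦ t).hasDerivWithinAt)
      (fun t ht => hmono t ⟨ht.1, ht.2.le⟩) τ ⟨hτ.1.le, le_rfl⟩
    simpa using this
  have h2 := norm_trapezoid_le hΦ hF hF' hB hτ'
  have h3 := hmono τ ⟨hτ.1.le, le_rfl⟩
  have h4 := hmono 0 ⟨le_rfl, hτ.1.le⟩
  have hsplit : τ⁻¹ • (y τ - y 0) - (2 : ℝ)⁻¹ • (y' τ + y' 0) =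
      τ⁻¹ • ((y τ - Φ τ - (y 0 - Φ 0)) + (Φ τ - Φ 0 - (τ / 2) • (F τ + F 0))) -
        ((2 : ℝ)⁻¹ • (y' τ - F τ) + (2 : ℝ)⁻¹ • (y' 0 - F 0)) := by
    have : τ⁻¹ • (τ / 2) • (F τ + F 0) = (2 : ℝ)⁻¹ • (F τ + F 0) := by
      rw [smul_smul]
      congr 1
      field_simp [hτ.1.ne']
    rw [smul_add τ⁻¹ (y τ - Φ τ - (y 0 - Φ 0)), smul_sub τ⁻¹ (Φ τ - Φ 0), this]
    module
  have hτ0 : 0 < τ⁻¹ := inv_pos.2 hτ.1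
  rw [hsplit]
  calc _ ≤ τ⁻¹ * (K * τ ^ p * τ + B * τ ^ 3) + (2⁻¹ * (K * τ ^ p) + 2⁻¹ * (K * τ ^ p)) := by
        refine (norm_sub_le _ _).trans (add_le_add ?_ ((norm_add_le _ _).trans (add_le_add ?_ ?_)))
        · rw [norm_smul, Real.norm_of_nonneg hτ0.le]
          exact mul_le_mul_of_nonneg_left ((norm_add_le _ _).trans (add_le_add h1 h2)) hτ0.le
        · rw [norm_smul, Real.norm_of_nonneg (by norm_num)]
          exact mul_le_mul_of_nonneg_left h3 (by norm_num)
        · rw [norm_smul, Real.norm_of_nonneg (by norm_num)]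
          exact mul_le_mul_of_nonneg_left h4 (by norm_num)
    _ = B * τ ^ 2 + 2 * K * τ ^ p := by
        have := hτ.1.ne'
        field_simp
        ring

end Trapezoid

/-! ### Fractional integrals near the origin -/

/-- The fractional integral of order `a` gains a power `a` at the origin. -/
theorem norm_fracIntegral_le {X : Type*} [NormedAddCommGroup X] [NormedSpace ℝ X]
    {a q M t : ℝ} (ha : 0 < a) (hq : 0 ≤ q) (hM : 0 ≤ M) (ht : 0 < t) {u : ℝ → X}
    (hu : ∀ s ∈ Icc 0 t, ‖u s‖ ≤ M * s ^ q) :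
    ‖fracIntegral a u t‖ ≤ (Real.Gamma a)⁻¹ * (M / a) * t ^ (q + a) := by
  have hG : 0 < (Real.Gamma a)⁻¹ := inv_pos.2 (Real.Gamma_pos_of_pos ha)
  have hint : IntervalIntegrable (fun s => (t - s) ^ (a - 1)) volume 0 t := by
    have := (intervalIntegral.intervalIntegrable_rpow' (a := t) (b := 0)
      (r := a - 1) (by linarith)).comp_sub_left t
    simpa using this
  have hval : ∫ s in (0 : ℝ)..t, (t - s) ^ (a - 1) = t ^ a / a := by
    rw [intervalIntegral.integral_comp_sub_left (fun s => s ^ (a - 1)) t, sub_self, sub_zero,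
      integral_rpow (Or.inl (by linarith)), sub_add_cancel, Real.zero_rpow ha.ne', sub_zero]
  have h := intervalIntegral.norm_integral_le_of_norm_le (μ := volume) ht.le
    (f := fun s => (t - s) ^ (a - 1) • u s) (g := fun s => (t - s) ^ (a - 1) * (M * t ^ q))
    (Eventually.of_forall fun s hs => ?_) (hint.mul_const _)
  · rw [intervalIntegral.integral_mul_const, hval] at h
    rw [fracIntegral, norm_smul, Real.norm_of_nonneg hG.le, mul_assoc]
    refine mul_le_mul_of_nonneg_left (h.trans (le_of_eq ?_)) hG.le
    rw [Real.rpow_add ht]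
    ring
  · have h0 : 0 ≤ (t - s) ^ (a - 1) := Real.rpow_nonneg (sub_nonneg.2 hs.2) _
    rw [norm_smul, Real.norm_of_nonneg h0]
    exact mul_le_mul_of_nonneg_left ((hu s ⟨hs.1.le, hs.2⟩).trans
      (mul_le_mul_of_nonneg_left (Real.rpow_le_rpow hs.1.le hs.2 hq) hM)) h0

/-! ### The strong form of the elasticity operator -/

section Space

variable {d : ℕ} {Ω : Set (E d)}

theorem FracVisco.HasWeakPartial.coord {j : Fin d} {u v : L2 Ω} (h : HasWeakPartial Ω j u v)
    (k : Fin d) {φ : E d → ℝ} (hφ : ContDiff ℝ ∞ φ) (hc : HasCompactSupport φ)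
    (hs : tsupport φ ⊆ Ω) :
    ∫ x in Ω, fderiv ℝ φ x (e j) * u x k = - ∫ x in Ω, φ x * v x k := by
  have hloc : ∀ z : L2 Ω, LocallyIntegrable z (volume.restrict Ω) := fun z =>
    (Lp.memLp z).locallyIntegrable (by norm_num)
  have h1 := (hloc u).integrable_smul_left_of_hasCompactSupport
    ((hφ.continuous_fderiv (by simp)).clm_apply continuous_const) (hc.fderiv_apply ℝ (e j))
  have h2 := (hloc v).integrable_smul_left_of_hasCompactSupport hφ.continuous hc
  have h3 := (EuclideanSpace.proj k : E d →L[ℝ] ℝ).integral_comp_comm h1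
  have h4 := (EuclideanSpace.proj k : E d →L[ℝ] ℝ).integral_comp_comm h2
  rw [h φ hφ hc hs, map_neg, ← h4] at h3
  simpa using h3

/-- The test function `φ e_i`, with `φ` smooth and compactly supported in `Ω`, as an element of
`V`. -/
theorem exists_testFunction (hΩ : IsOpen Ω) (ΓD : Set (E d)) (i : Fin d) {φ : E d → ℝ}
    (hφ : ContDiff ℝ ∞ φ) (hc : HasCompactSupport φ) (hs : tsupport φ ⊆ Ω) :
    ∃ v : H1 Ω, (∀ᵐ x ∂(volume.restrict Ω), valH1 v x = φ x • e i) ∧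
      (∀ j, ∀ᵐ x ∂(volume.restrict Ω), gradH1 v j x = fderiv ℝ φ x (e j) • e i) ∧
      IsTraceV ΓD v 0 := by
  have hm : ∀ ψ : E d → ℝ, Continuous ψ → HasCompactSupport ψ →
      MemLp (fun x => ψ x • (e i : E d)) 2 (volume.restrict Ω) := fun ψ h1 h2 =>
    ((h1.smul continuous_const).memLp_of_hasCompactSupport h2.smul_right).restrict Ω
  have hd : ∀ j, Continuous fun x => fderiv ℝ φ x (e j) := fun j =>
    (hφ.continuous_fderiv (by simp)).clm_apply continuous_const
  have hdc : ∀ j : Fin d, HasCompactSupport fun x => fderiv ℝ φ x (e j) := fun j =>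
    hc.fderiv_apply ℝ (e j)
  set u0 : L2 Ω := (hm φ hφ.continuous hc).toLp
  set u1 : Fin d → L2 Ω := fun j => (hm _ (hd j) (hdc j)).toLp
  have hu0 : ∀ᵐ x ∂(volume.restrict Ω), u0 x = φ x • e i := (hm φ hφ.continuous hc).coeFn_toLp
  have hu1 : ∀ j, ∀ᵐ x ∂(volume.restrict Ω), u1 j x = fderiv ℝ φ x (e j) • e i := fun j =>
    (hm _ (hd j) (hdc j)).coeFn_toLp
  have hweak : ∀ j, HasWeakPartial Ω j u0 (u1 j) := by
    intro j ψ hψ hψc hψs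
    have e1 : ∫ x in Ω, fderiv ℝ ψ x (e j) • u0 x =
        ∫ x in Ω, (fderiv ℝ ψ x (e j) * φ x) • (e i : E d) := by
      refine integral_congr_ae ?_
      filter_upwards [hu0] with x hx
      rw [hx, smul_smul]
    have e2 : ∫ x in Ω, ψ x • u1 j x = ∫ x in Ω, (ψ x * fderiv ℝ φ x (e j)) • (e i : E d) := by
      refine integral_congr_ae ?_
      filter_upwards [hu1 j] with x hx
      rw [hx, smul_smul]
    have z1 : ∫ x in Ω, fderiv ℝ ψ x (e j) * φ x = ∫ x, fderiv ℝ ψ x (e j) * φ x :=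
      setIntegral_eq_integral_of_forall_compl_eq_zero fun x hx => by
        rw [image_eq_zero_of_notMem_tsupport fun h => hx (hs h), mul_zero]
    have z2 : ∫ x in Ω, ψ x * fderiv ℝ φ x (e j) = ∫ x, ψ x * fderiv ℝ φ x (e j) :=
      setIntegral_eq_integral_of_forall_compl_eq_zero fun x hx => by
        rw [image_eq_zero_of_notMem_tsupport fun h => hx (hψs h), zero_mul]
    have hψd : Continuous fun x => fderiv ℝ ψ x (e j) :=
      (hψ.continuous_fderiv (by simp)).clm_apply continuous_const
    have ibp := integral_mul_fderiv_eq_neg_fderiv_mul_of_integrable (μ := volume) (v := e j)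
      (f := ψ) (g := φ)
      ((hψd.mul hφ.continuous).integrable_of_hasCompactSupport hc.mul_left)
      ((hψ.continuous.mul (hd j)).integrable_of_hasCompactSupport hψc.mul_right)
      ((hψ.continuous.mul hφ.continuous).integrable_of_hasCompactSupport hψc.mul_right)
      (fun x _ => (hψ.differentiable (by simp)) x) (fun x _ => (hφ.differentiable (by simp)) x)
    rw [e1, e2, integral_smul_const, integral_smul_const, z1, z2, ibp, neg_smul, neg_neg]
  have htend : ∀ {μ : Measure (E d)} {g : E d → E d}, g =ᵐ[μ] 0 →
      Tendsto (fun _ : ℕ => eLpNorm g 2 μ) atTop (𝓝 0) := fun h => by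
    rw [eLpNorm_congr_ae h, eLpNorm_zero]
    exact tendsto_const_nhds
  let v : H1 Ω := ⟨WithLp.toLp 2 (Sum.elim (fun _ => u0) u1), hweak⟩
  have hv0 : ∀ᵐ x ∂(volume.restrict Ω), valH1 v x = φ x • e i := hu0
  have hv1 : ∀ j, ∀ᵐ x ∂(volume.restrict Ω), gradH1 v j x = fderiv ℝ φ x (e j) • e i := hu1
  refine ⟨v, hv0, hv1, ⟨fun _ x => φ x • e i, fun _ => hφ.smul contDiff_const, ?_, ?_, ?_⟩, ?_⟩
  · refine htend ?_
    filter_upwards [hv0] with x hx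
    simp [hx]
  · refine fun j => htend ?_
    filter_upwards [hv1 j] with x hx
    rw [hx, fderiv_smul_const (hφ.differentiable (by simp) x)]
    simp
  · refine htend ?_
    filter_upwards [Lp.coeFn_zero (E d) 2 (surface Ω),
      ae_restrict_mem isClosed_frontier.measurableSet] with x hx hm
    have : x ∉ tsupport φ := fun h => (hΩ.frontier_eq ▸ hm).2 (hs h)
    rw [hx, image_eq_zero_of_notMem_tsupport this]
    simp
  · exact ae_restrict_of_ae (Lp.coeFn_zero (E d) 2 (surface Ω))

/-- The second derivative `∂_k ∂_j u` of an `H^2` function. -/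
def hessH2 (u : H2 Ω) (j k : Fin d) : L2 Ω := u.1 (Sum.inr (Sum.inr (j, k)))

/-- The derivative `∂_b ε_{kl}(u)` of the strain of an `H^2` function. -/
noncomputable def strainDeriv (u : H2 Ω) (k l b : Fin d) (x : E d) : ℝ :=
  (hessH2 u l b x k + hessH2 u k b x l) / 2

theorem locallyIntegrable_coord (u : L2 Ω) (k : Fin d) :
    LocallyIntegrable (fun x => u x k) (volume.restrict Ω) :=
  ((EuclideanSpace.proj k : E d →L[ℝ] ℝ).comp_memLp' (Lp.memLp u)).locallyIntegrable
    (by norm_num)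

theorem locallyIntegrable_strain (u : H1 Ω) (k l : Fin d) :
    LocallyIntegrable (strain u k l) (volume.restrict Ω) := by
  have := ((locallyIntegrable_coord (gradH1 u l) k).add
    (locallyIntegrable_coord (gradH1 u k) l)).smul (2 : ℝ)⁻¹
  refine this.congr (Eventually.of_forall fun x => ?_)
  simp [strain, div_eq_inv_mul]

theorem locallyIntegrable_strainDeriv (u : H2 Ω) (k l b : Fin d) :
    LocallyIntegrable (strainDeriv u k l b) (volume.restrict Ω) := by
  have := ((locallyIntegrable_coord (hessH2 u l b) k).add
    (locallyIntegrable_coord (hessH2 u k b) l)).smul (2 : ℝ)⁻¹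
  refine this.congr (Eventually.of_forall fun x => ?_)
  simp [strainDeriv, div_eq_inv_mul]

theorem integral_fderiv_mul_strain (u : H2 Ω) (k l b : Fin d) {φ : E d → ℝ}
    (hφ : ContDiff ℝ ∞ φ) (hc : HasCompactSupport φ) (hs : tsupport φ ⊆ Ω) :
    ∫ x in Ω, fderiv ℝ φ x (e b) * strain (toH1 u) k l x =
      - ∫ x in Ω, φ x * strainDeriv u k l b x := by
  have h1 := (u.2.2 l b).coord k hφ hc hs
  have h2 := (u.2.2 k b).coord l hφ hc hs
  have hd : Continuous fun x => fderiv ℝ φ x (e b) :=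
    (hφ.continuous_fderiv (by simp)).clm_apply continuous_const
  have hdc : HasCompactSupport fun x => fderiv ℝ φ x (e b) := hc.fderiv_apply ℝ (e b)
  have i1 : ∀ (z : L2 Ω) (k : Fin d),
      Integrable (fun x => fderiv ℝ φ x (e b) * z x k) (volume.restrict Ω) := fun z k =>
    (locallyIntegrable_coord z k).integrable_smul_left_of_hasCompactSupport hd hdc
  have i2 : ∀ (z : L2 Ω) (k : Fin d),
      Integrable (fun x => φ x * z x k) (volume.restrict Ω) := fun z k =>
    (locallyIntegrable_coord z k).integrable_smul_left_of_hasCompactSupport hφ.continuous hc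
  have e1 : ∀ x, fderiv ℝ φ x (e b) * strain (toH1 u) k l x =
      (fderiv ℝ φ x (e b) * u.1 (Sum.inr (Sum.inl l)) x k +
        fderiv ℝ φ x (e b) * u.1 (Sum.inr (Sum.inl k)) x l) / 2 := fun x => by
    change fderiv ℝ φ x (e b) *
      ((u.1 (Sum.inr (Sum.inl l)) x k + u.1 (Sum.inr (Sum.inl k)) x l) / 2) = _
    ring
  have e2 : ∀ x, φ x * strainDeriv u k l b x =
      (φ x * u.1 (Sum.inr (Sum.inr (l, b))) x k +
        φ x * u.1 (Sum.inr (Sum.inr (k, b))) x l) / 2 := fun x => by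
    rw [strainDeriv, hessH2, hessH2]
    ring
  simp only [e1, e2]
  rw [integral_div, integral_div, integral_add (i1 _ _) (i1 _ _), integral_add (i2 _ _) (i2 _ _),
    h1, h2]
  ring

/-- Contraction of a symmetric matrix with the strain of `φ e_i`, where `p = ∇φ`. -/
theorem sum_mul_symm_single (q : Fin d → Fin d → ℝ) (hq : ∀ a b, q a b = q b a) (i : Fin d)
    (p : Fin d → ℝ) :
    ∑ a, ∑ b, q a b * ((p b * (e i : E d) a + p a * (e i : E d) b) / 2) = ∑ b, q i b * p b := by
  have h1 : ∑ a, ∑ b, q a b * (p b * (e i : E d) a) = ∑ b, q i b * p b := by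
    rw [Finset.sum_comm]
    simp
  have h2 : ∑ a, ∑ b, q a b * (p a * (e i : E d) b) = ∑ b, q i b * p b := by
    simp [hq i]
  calc _ = (∑ a, ∑ b, q a b * (p b * (e i : E d) a) +
        ∑ a, ∑ b, q a b * (p a * (e i : E d) b)) / 2 := by
        rw [← Finset.sum_add_distrib, Finset.sum_div]
        refine Finset.sum_congr rfl fun a _ => ?_
        rw [← Finset.sum_add_distrib, Finset.sum_div]
        exact Finset.sum_congr rfl fun b _ => by ring
    _ = _ := by rw [h1, h2]; ring

/-- If `(R, v) = -a(U, v)` for all `v` of vanishing trace, then on an open set where the tensor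
field is a constant `C` the function `R` is the pointwise divergence of the stress `C ε(U)`. Only
test functions supported in that set are needed, so jumps of the tensor field play no role. -/
theorem ae_eq_div_stress (hΩ : IsOpen Ω) {ΓD W : Set (E d)} (hW : IsOpen W) (hWΩ : W ⊆ Ω)
    {D : E d → Tensor4 d} {C : Tensor4 d} (hC : ∀ i j k l, C i j k l = C j i k l)
    (hDC : ∀ x ∈ W, D x = C) {U : H2 Ω} {R : L2 Ω}
    (hR : ∀ v : H1 Ω, IsTraceV ΓD v 0 → inner ℝ R (valH1 v) + bilin D (toH1 U) v = 0)
    (i : Fin d) :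
    ∀ᵐ x ∂(volume.restrict Ω), x ∈ W →
      R x i = ∑ b, ∑ k, ∑ l, C i b k l * strainDeriv U k l b x := by
  have hl : LocallyIntegrable (fun x => R x i - ∑ b, ∑ k, ∑ l, C i b k l * strainDeriv U k l b x)
      (volume.restrict Ω) := by
    refine (locallyIntegrable_coord R i).sub ?_
    refine locallyIntegrable_finsetSum _ fun b _ => locallyIntegrable_finsetSum _ fun k _ =>
      locallyIntegrable_finsetSum _ fun l _ => ?_
    exact (locallyIntegrable_strainDeriv U k l b).smul (C i b k l)
  have key := hW.ae_eq_zero_of_integral_contDiff_smul_eq_zero (μ := volume.restrict Ω)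
     (hl.locallyIntegrableOn W) ?_
  · filter_upwards [key] with x hx hm using sub_eq_zero.1 (hx hm)
  intro φ hφ hc hsW
  have hs : tsupport φ ⊆ Ω := hsW.trans hWΩ
  obtain ⟨v, hv0, hv1, hvt⟩ := exists_testFunction hΩ ΓD i hφ hc hs
  have hRv := hR v hvt
  have hin : inner ℝ R (valH1 v) = ∫ x in Ω, φ x * R x i := by
    rw [L2.inner_def]
    refine integral_congr_ae ?_
    filter_upwards [hv0] with x hx
    rw [hx, inner_smul_right, EuclideanSpace.inner_single_right]
    simp
  have hd : ∀ b, Continuous fun x => fderiv ℝ φ x (e b) := fun b =>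
    (hφ.continuous_fderiv (by simp)).clm_apply continuous_const
  have hdc : ∀ b : Fin d, HasCompactSupport fun x => fderiv ℝ φ x (e b) := fun b =>
    hc.fderiv_apply ℝ (e b)
  have hi1 : ∀ b k l, Integrable (fun x => fderiv ℝ φ x (e b) * strain (toH1 U) k l x)
      (volume.restrict Ω) := fun b k l =>
    (locallyIntegrable_strain _ k l).integrable_smul_left_of_hasCompactSupport (hd b) (hdc b)
  have hi2 : ∀ b k l, Integrable (fun x => φ x * strainDeriv U k l b x)
      (volume.restrict Ω) := fun b k l =>
    (locallyIntegrable_strainDeriv U k l b).integrable_smul_left_of_hasCompactSupport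
      hφ.continuous hc
  have hbil : bilin D (toH1 U) v = ∫ x in Ω, ∑ b, ∑ k, ∑ l,
      C i b k l * (fderiv ℝ φ x (e b) * strain (toH1 U) k l x) := by
    refine integral_congr_ae ?_
    filter_upwards [ae_all_iff.2 hv1] with x hx
    -- off `W` both integrands vanish with `∇φ`, and on `W` the tensor is `C`
    have hst : ∀ a b, strain v a b x = (fderiv ℝ φ x (e b) * (e i : E d) a +
        fderiv ℝ φ x (e a) * (e i : E d) b) / 2 := fun a b => by
      rw [strain, hx, hx]
      simp
    by_cases hxW : x ∈ W
    · have := sum_mul_symm_single (fun a b => ∑ k, ∑ l, C a b k l * strain (toH1 U) k l x)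
        (fun a b => Finset.sum_congr rfl fun k _ => Finset.sum_congr rfl fun l _ => by rw [hC])
        i (fun b => fderiv ℝ φ x (e b))
      simp only [hst, hDC x hxW]
      simp only [Finset.sum_mul] at this
      rw [this]
      refine Finset.sum_congr rfl fun b _ => Finset.sum_congr rfl fun k _ =>
        Finset.sum_congr rfl fun l _ => by ring
    · have h0 : fderiv ℝ φ x = 0 := by
        have : x ∉ tsupport (fderiv ℝ φ) := fun h => hxW (hsW (tsupport_fderiv_subset ℝ h))
        exact image_eq_zero_of_notMem_tsupport this
      simp [hst, h0]
  have hdiv : bilin D (toH1 U) v =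
      - ∫ x in Ω, ∑ b, ∑ k, ∑ l, C i b k l * (φ x * strainDeriv U k l b x) := by
    rw [hbil]
    have c1 := fun b k l => (hi1 b k l).const_mul (C i b k l)
    have c2 := fun b k l => (hi2 b k l).const_mul (C i b k l)
    rw [integral_finsetSum _ fun b _ => integrable_finsetSum _ fun k _ =>
        integrable_finsetSum _ fun l _ => c1 b k l,
      integral_finsetSum _ fun b _ => integrable_finsetSum _ fun k _ =>
        integrable_finsetSum _ fun l _ => c2 b k l, ← Finset.sum_neg_distrib]
    refine Finset.sum_congr rfl fun b _ => ?_
    rw [integral_finsetSum _ fun k _ => integrable_finsetSum _ fun l _ => c1 b k l,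
      integral_finsetSum _ fun k _ => integrable_finsetSum _ fun l _ => c2 b k l,
      ← Finset.sum_neg_distrib]
    refine Finset.sum_congr rfl fun k _ => ?_
    rw [integral_finsetSum _ fun l _ => c1 b k l, integral_finsetSum _ fun l _ => c2 b k l,
      ← Finset.sum_neg_distrib]
    refine Finset.sum_congr rfl fun l _ => ?_
    rw [integral_const_mul, integral_const_mul, integral_fderiv_mul_strain U k l b hφ hc hs,
      mul_neg]
  have hsub := integral_sub
    ((locallyIntegrable_coord R i).integrable_smul_left_of_hasCompactSupport hφ.continuous hc)
    (integrable_finsetSum Finset.univ fun b _ => integrable_finsetSum Finset.univ fun k _ =>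
      integrable_finsetSum Finset.univ fun l _ => (hi2 b k l).const_mul (C i b k l))
  simp only [smul_eq_mul] at hsub
  rw [hin, hdiv, ← sub_eq_add_neg, ← hsub] at hRv
  rw [← hRv]
  refine integral_congr_ae (Eventually.of_forall fun x => ?_)
  simp only [smul_eq_mul, mul_sub, Finset.mul_sum]
  congr 1
  exact Finset.sum_congr rfl fun b _ => Finset.sum_congr rfl fun k _ =>
    Finset.sum_congr rfl fun l _ => by ring

theorem norm_le_mul_sum_of_ae_le {ι : Type*} (s : Finset ι) {c : ℝ} (hc : 0 ≤ c) {R : L2 Ω}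
    {G : ι → L2 Ω} (h : ∀ᵐ x ∂(volume.restrict Ω), ‖R x‖ ≤ c * ∑ n ∈ s, ‖G n x‖) :
    ‖R‖ ≤ c * ∑ n ∈ s, ‖G n‖ := by
  have hG : ∀ n, MemLp (fun x => ‖G n x‖) 2 (volume.restrict Ω) := fun n => (Lp.memLp (G n)).norm
  have hsum : ⇑(∑ n ∈ s, (hG n).toLp) =ᵐ[volume.restrict Ω] fun x => ∑ n ∈ s, ‖G n x‖ := by
    refine (Lp.coeFn_finsetSum s _).trans ?_
    filter_upwards [(Finset.eventually_all s).2 fun n _ => (hG n).coeFn_toLp] with x hx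
    rw [Finset.sum_apply]
    exact Finset.sum_congr rfl hx
  have h1 : ‖R‖ ≤ c * ‖∑ n ∈ s, (hG n).toLp‖ := by
    refine Lp.norm_le_mul_norm_of_ae_le_mul ?_
    filter_upwards [h, hsum] with x hx hs
    rw [hs, Real.norm_of_nonneg (Finset.sum_nonneg fun n _ => norm_nonneg _)]
    exact hx
  refine h1.trans (mul_le_mul_of_nonneg_left ((norm_sum_le _ _).trans (Finset.sum_le_sum ?_)) hc)
  intro n _
  rw [Lp.norm_toLp, eLpNorm_norm, Lp.norm_def]

/-- The `L_2` function `R` that represents `v ↦ -a(U, v)` on functions of vanishing trace is bounded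
by the `H^2` norm of `U`, with a constant that depends on the tensor field only. -/
theorem exists_norm_le_of_weak_eq (hΩ : IsOpen Ω) (ΓD : Set (E d)) {D : E d → Tensor4 d}
    (hD : IsPiecewiseSPD Ω D) :
    ∃ A : ℝ, 0 ≤ A ∧ ∀ (U : H2 Ω) (R : L2 Ω),
      (∀ v : H1 Ω, IsTraceV ΓD v 0 → inner ℝ R (valH1 v) + bilin D (toH1 U) v = 0) →
      ‖R‖ ≤ A * ‖U‖ := by
  obtain ⟨M, W, C, hW, -, hfill, hC⟩ := hD
  set A : ℝ := ∑ m, ∑ i, ∑ b, ∑ k, ∑ l, |C m i b k l| with hA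
  have hA0 : 0 ≤ A := by positivity
  refine ⟨A * (Finset.univ : Finset (Fin d × Fin d)).card, by positivity, fun U R hR => ?_⟩
  have hae : ∀ᵐ x ∂(volume.restrict Ω), ‖R x‖ ≤ A * ∑ n : Fin d × Fin d, ‖hessH2 U n.1 n.2 x‖ := by
    have h1 : ∀ᵐ x ∂(volume.restrict Ω), ∀ m i, x ∈ W m →
        R x i = ∑ b, ∑ k, ∑ l, C m i b k l * strainDeriv U k l b x :=
      ae_all_iff.2 fun m => ae_all_iff.2 fun i =>
        ae_eq_div_stress hΩ (hW m).1 (hW m).2 (hC m).1.minor (hC m).2 hR i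
    have h2 : ∀ᵐ x ∂(volume.restrict Ω), x ∈ ⋃ m, W m := by
      rw [ae_restrict_iff' hΩ.measurableSet, ae_iff]
      convert hfill using 2
      ext x
      simp
    filter_upwards [h1, h2] with x hx1 hx2
    obtain ⟨m, hm⟩ := mem_iUnion.1 hx2
    have hsingle : ∀ G : Fin d × Fin d → ℝ, (∀ n, 0 ≤ G n) → ∀ n, G n ≤ ∑ n, G n :=
      fun G h n => Finset.single_le_sum (fun n _ => h n) (Finset.mem_univ n)
    have hN1 : ∀ j k, ‖hessH2 U j k x‖ ≤ ∑ n : Fin d × Fin d, ‖hessH2 U n.1 n.2 x‖ := fun j k =>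
      hsingle (fun n => ‖hessH2 U n.1 n.2 x‖) (fun n => norm_nonneg _) (j, k)
    have hN0 : 0 ≤ ∑ n : Fin d × Fin d, ‖hessH2 U n.1 n.2 x‖ :=
      Finset.sum_nonneg fun n _ => norm_nonneg _
    generalize ∑ n : Fin d × Fin d, ‖hessH2 U n.1 n.2 x‖ = N at hN1 hN0 ⊢
    have hS : ∀ k l b, |strainDeriv U k l b x| ≤ N := by
      intro k l b
      have a1 : |hessH2 U l b x k| ≤ N := (PiLp.norm_apply_le _ k).trans (hN1 l b)
      have a2 : |hessH2 U k b x l| ≤ N := (PiLp.norm_apply_le _ l).trans (hN1 k b)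
      rw [strainDeriv, abs_div, abs_two]
      linarith [abs_add_le (hessH2 U l b x k) (hessH2 U k b x l)]
    have hRi : ∀ i, |R x i| ≤ (∑ b, ∑ k, ∑ l, |C m i b k l|) * N := by
      intro i
      rw [hx1 m i hm]
      simp only [Finset.sum_mul]
      refine (Finset.abs_sum_le_sum_abs _ _).trans (Finset.sum_le_sum fun b _ => ?_)
      refine (Finset.abs_sum_le_sum_abs _ _).trans (Finset.sum_le_sum fun k _ => ?_)
      refine (Finset.abs_sum_le_sum_abs _ _).trans (Finset.sum_le_sum fun l _ => ?_)
      rw [abs_mul]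
      exact mul_le_mul_of_nonneg_left (hS k l b) (abs_nonneg _)
    have hRx : ‖R x‖ ≤ ∑ i, |R x i| := by
      calc ‖R x‖ = ‖∑ i, R x i • (e i : E d)‖ := by
            congr 1
            ext j
            simp [Pi.single_apply]
        _ ≤ ∑ i, ‖R x i • (e i : E d)‖ := norm_sum_le _ _
        _ = ∑ i, |R x i| := by simp [norm_smul]
    have hCm : ∑ i, ∑ b, ∑ k, ∑ l, |C m i b k l| ≤ A :=
      Finset.single_le_sum (f := fun m => ∑ i, ∑ b, ∑ k, ∑ l, |C m i b k l|)
        (fun m _ => by positivity) (Finset.mem_univ m)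
    calc ‖R x‖ ≤ ∑ i, |R x i| := hRx
      _ ≤ ∑ i, (∑ b, ∑ k, ∑ l, |C m i b k l|) * N := Finset.sum_le_sum fun i _ => hRi i
      _ = (∑ i, ∑ b, ∑ k, ∑ l, |C m i b k l|) * N := by rw [Finset.sum_mul]
      _ ≤ A * N := mul_le_mul_of_nonneg_right hCm hN0
  refine (norm_le_mul_sum_of_ae_le Finset.univ hA0 hae).trans ?_
  rw [mul_assoc]
  refine mul_le_mul_of_nonneg_left ?_ hA0
  rw [← nsmul_eq_mul]
  exact Finset.sum_le_card_nsmul _ _ _ fun n _ => PiLp.norm_apply_le U.1 _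

end Space

/-! ### The truncation error of the first time step -/

/-- The underlying `L_2` function of an `H^2` function, as a continuous linear map. -/
noncomputable def valH2L {d : ℕ} (Ω : Set (E d)) : H2 Ω →L[ℝ] L2 Ω :=
  (PiLp.proj 2 (fun _ : Unit ⊕ (Fin d ⊕ (Fin d × Fin d)) => L2 Ω) (Sum.inl ())).comp
    (H2 Ω).subtypeL

/-- Testing the weak form with functions of vanishing trace shows that the residual `ρ ẇ - f` is
controlled by the fractional integral of `w`. -/
theorem FracVisco.IsSolution.exists_norm_residual_le {d : ℕ} {Ω ΓD : Set (E d)} (hΩ : IsOpen Ω)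
    {D : E d → Tensor4 d} (hD : IsPiecewiseSPD Ω D) {ρ α T : ℝ} {f : ℝ → H2 Ω}
    {gN : ℝ → Lp (E d) 2 ((Measure.euclideanHausdorffMeasure (d - 1)).restrict
      (frontier Ω \ ΓD))} {w : ℝ → H2 Ω} (hw : IsSolution ΓD D ρ α T f gN w) :
    ∃ A : ℝ, 0 ≤ A ∧ ∀ t ∈ Ioc 0 T,
      ‖ρ • valH2 (derivWithin w (Icc 0 T) t) - valH2 (f t)‖ ≤
        A * ‖fracIntegral (1 - α) w t‖ := by
  obtain ⟨A, hA, h⟩ := exists_norm_le_of_weak_eq hΩ ΓD hD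
  refine ⟨A, hA, fun t ht => h _ _ fun v hv => ?_⟩
  -- the zero trace removes the Neumann term
  have hbd : ∫ x in frontier Ω \ ΓD, inner ℝ (gN t x) ((0 : Lp (E d) 2 (surface Ω)) x)
      ∂(Measure.euclideanHausdorffMeasure (d - 1)) = 0 := by
    refine integral_eq_zero_of_ae ?_
    filter_upwards [ae_mono (Measure.restrict_mono_set _ sdiff_subset)
      (Lp.coeFn_zero (E d) 2 (surface Ω))] with x hx
    rw [hx]
    exact inner_zero_right _
  have := hw.weak t ht v 0 hv
  rw [hbd, add_zero] at this
  rw [inner_sub_left]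
  linarith

/-- A solution of size `t ^ q` has a truncation error of order `τ ^ 2 + τ ^ (q + 1 - α)`. -/
theorem FracVisco.IsSolution.exists_norm_truncationError_le {d : ℕ} {Ω ΓD : Set (E d)}
    (hΩ : IsOpen Ω) {D : E d → Tensor4 d} (hD : IsPiecewiseSPD Ω D) {ρ α T : ℝ} (hρ : 0 < ρ)
    (hα : α < 1) (hT : 0 < T) {f : ℝ → H2 Ω} (hf : MemSobolevTime 3 1 T (fun t => valH2 (f t)))
    {gN : ℝ → Lp (E d) 2 ((Measure.euclideanHausdorffMeasure (d - 1)).restrict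
      (frontier Ω \ ΓD))} {w : ℝ → H2 Ω} (hw : IsSolution ΓD D ρ α T f gN w)
    (hw1 : ContDiffOn ℝ 1 w (Icc 0 T)) {q M : ℝ} (hq : 0 ≤ q) (hM : 0 ≤ M)
    (hwM : ∀ t ∈ Icc 0 T, ‖w t‖ ≤ M * t ^ q) :
    ∃ B K : ℝ, 0 ≤ B ∧ 0 ≤ K ∧ ∀ τ ∈ Ioc 0 T,
      ‖truncationError T w τ‖ ≤ B * τ ^ 2 + K * τ ^ (q + (1 - α)) := by
  obtain ⟨A, hA, hres⟩ := hw.exists_norm_residual_le hΩ hD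
  have hα' : 0 < 1 - α := sub_pos.2 hα
  set G : ℝ := (Real.Gamma (1 - α))⁻¹ * (M / (1 - α)) with hG
  have hG0 : 0 ≤ G := mul_nonneg (inv_nonneg.2 (Real.Gamma_pos_of_pos hα').le)
    (div_nonneg hM hα'.le)
  have hd : ∀ t ∈ Icc 0 T, HasDerivWithinAt (fun t => ρ • valH2 (w t))
      (ρ • valH2 (derivWithin w (Icc 0 T) t)) (Icc 0 T) t := fun t ht =>
    ((valH2L Ω).hasFDerivAt.comp_hasDerivWithinAt t
      ((hw1.differentiableOn (by simp)) t ht).hasDerivWithinAt).const_smul ρ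
  have hc : ContinuousOn (fun t => ρ • valH2 (derivWithin w (Icc 0 T) t)) (Icc 0 T) :=
    ((valH2L Ω).continuous.comp_continuousOn
      (hw1.continuousOn_derivWithin (uniqueDiffOn_Icc hT) le_rfl)).const_smul ρ
  obtain ⟨B, hB, h⟩ := exists_norm_crankNicolson_le (p := q + (1 - α)) (K := A * G) hT
    (by linarith) (mul_nonneg hA hG0) hd hc hf fun t ht => by
      refine (hres t ht).trans ?_
      rw [mul_assoc]
      exact mul_le_mul_of_nonneg_left (norm_fracIntegral_le hα' hq hM ht.1 fun s hs =>
        hwM s ⟨hs.1, hs.2.trans ht.2⟩) hA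
  refine ⟨ρ⁻¹ * B, ρ⁻¹ * (2 * (A * G)), by positivity, by positivity, fun τ hτ => ?_⟩
  have he : truncationError T w τ = ρ⁻¹ • (τ⁻¹ • (ρ • valH2 (w τ) - ρ • valH2 (w 0)) -
      (2 : ℝ)⁻¹ • (ρ • valH2 (derivWithin w (Icc 0 T) τ) +
        ρ • valH2 (derivWithin w (Icc 0 T) 0))) := by
    have h1 : truncationError T w τ = τ⁻¹ • (valH2 (w τ) - valH2 (w 0)) -
        (2 : ℝ)⁻¹ • (valH2 (derivWithin w (Icc 0 T) τ) + valH2 (derivWithin w (Icc 0 T) 0)) := rfl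
    rw [h1, ← smul_sub, ← smul_add, smul_comm τ⁻¹ ρ, smul_comm (2 : ℝ)⁻¹ ρ, ← smul_sub,
      inv_smul_smul₀ hρ.ne']
  rw [he, norm_smul, Real.norm_of_nonneg (inv_nonneg.2 hρ.le)]
  calc _ ≤ ρ⁻¹ * (B * τ ^ 2 + 2 * (A * G) * τ ^ (q + (1 - α))) :=
        mul_le_mul_of_nonneg_left (h τ hτ) (inv_nonneg.2 hρ.le)
    _ = _ := by ring

theorem rpow_add_le_mul_rpow {T τ r s : ℝ} (hτ : τ ∈ Ioc 0 T) (hr : 0 ≤ r) :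
    τ ^ (r + s) ≤ T ^ r * τ ^ s := by
  rw [Real.rpow_add hτ.1]
  exact mul_le_mul_of_nonneg_right (Real.rpow_le_rpow hτ.1.le hτ.2 hr) (Real.rpow_nonneg hτ.1.le _)

theorem mainTheorem6 {d : ℕ} (hd : 1 ≤ d) (Ω ΓD : Set (E d)) (hΩ : IsConvexPolytope Ω)
    (hΓD : MeasurableSet ΓD) (hΓDsub : ΓD ⊆ frontier Ω) (hΓDpos : 0 < surface Ω ΓD)
    (D : E d → Tensor4 d) (hD : IsPiecewiseSPD Ω D)
    (ρ α T : ℝ) (hρ : 0 < ρ) (hα : α ∈ Ioo (0 : ℝ) 1) (hT : 0 < T)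
    (f : ℝ → H2 Ω)
    (hf1 : MemSobolevTime 3 1 T (fun t => valH2 (f t))) (hf2 : MemSobolevTime 2 2 T f)
    (gN : ℝ → Lp (E d) 2 ((Measure.euclideanHausdorffMeasure (d - 1)).restrict
      (frontier Ω \ ΓD)))
    (w : ℝ → H2 Ω) (hw : IsSolution ΓD D ρ α T f gN w)
    (hw1 : ContDiffOn ℝ 1 w (Icc 0 T)) (hw0 : w 0 = 0) :
    (∃ C : ℝ, 0 < C ∧ ∀ τ ∈ Ioc 0 T, ‖truncationError T w τ‖ ≤ C * τ ^ (2 - α)) ∧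
    (ContDiffOn ℝ 2 w (Icc 0 T) → derivWithin w (Icc 0 T) 0 = 0 →
      ∃ C : ℝ, 0 < C ∧ ∀ τ ∈ Ioc 0 T, ‖truncationError T w τ‖ ≤ C * τ ^ 2) := by
  have hopen : IsOpen Ω := by
    obtain ⟨-, P, -, rfl⟩ := hΩ
    exact isOpen_interior
  have hd1 : DifferentiableOn ℝ w (Icc 0 T) := hw1.differentiableOn (by simp)
  have h0 : (0 : ℝ) ∈ Icc 0 T := ⟨le_rfl, hT.le⟩
  refine ⟨?_, fun hw2 hw0' => ?_⟩
  · obtain ⟨M, hM⟩ := isCompact_Icc.exists_bound_of_continuousOn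
      (hw1.continuousOn_derivWithin (uniqueDiffOn_Icc hT) le_rfl)
    have hM0 : 0 ≤ M := (norm_nonneg _).trans (hM 0 h0)
    have hwM : ∀ t ∈ Icc 0 T, ‖w t‖ ≤ M * t ^ (1 : ℝ) := fun t ht => by
      have := norm_image_sub_le_of_norm_deriv_le_segment hd1
        (fun s hs => hM s (Ico_subset_Icc_self hs)) t ht
      simpa [hw0] using this
    obtain ⟨B, K, hB, hK, h⟩ :=
      hw.exists_norm_truncationError_le hopen hD hρ hα.2 hT hf1 hw1 zero_le_one hM0 hwM
    refine ⟨B * T ^ α + K + 1, by positivity, fun τ hτ => (h τ hτ).trans ?_⟩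
    have hτ2 : τ ^ 2 ≤ T ^ α * τ ^ (2 - α) := by
      have := rpow_add_le_mul_rpow (s := 2 - α) hτ hα.1.le
      rwa [add_sub_cancel, Real.rpow_two] at this
    have hp : 0 ≤ τ ^ (2 - α) := Real.rpow_nonneg hτ.1.le _
    have he : (1 : ℝ) + (1 - α) = 2 - α := by ring
    rw [he]
    nlinarith [mul_le_mul_of_nonneg_left hτ2 hB]
  · have hw2' : ContDiffOn ℝ 1 (derivWithin w (Icc 0 T)) (Icc 0 T) :=
      hw2.derivWithin (uniqueDiffOn_Icc hT) (by norm_num)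
    obtain ⟨M, hM⟩ := isCompact_Icc.exists_bound_of_continuousOn
      (hw2'.continuousOn_derivWithin (uniqueDiffOn_Icc hT) le_rfl)
    have hM0 : 0 ≤ M := (norm_nonneg _).trans (hM 0 h0)
    have hwM' : ∀ t ∈ Icc 0 T, ‖derivWithin w (Icc 0 T) t‖ ≤ M * t := fun t ht => by
      have := norm_image_sub_le_of_norm_deriv_le_segment (hw2'.differentiableOn (by simp))
        (fun s hs => hM s (Ico_subset_Icc_self hs)) t ht
      simpa [hw0'] using this
    have hwM : ∀ t ∈ Icc 0 T, ‖w t‖ ≤ M * t ^ (2 : ℝ) := fun t ht => by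
      have := norm_image_sub_le_of_norm_deriv_le_segment' (f := w)
        (f' := derivWithin w (Icc 0 T)) (a := 0) (b := t) (C := M * t)
        (fun s hs => (hd1 s ⟨hs.1, hs.2.trans ht.2⟩).hasDerivWithinAt.mono
          (Icc_subset_Icc_right ht.2))
        (fun s hs => (hwM' s ⟨hs.1, hs.2.le.trans ht.2⟩).trans
          (mul_le_mul_of_nonneg_left hs.2.le hM0)) t ⟨ht.1, le_rfl⟩
      rw [hw0, sub_zero, sub_zero] at this
      rw [Real.rpow_two]
      linarith
    obtain ⟨B, K, hB, hK, h⟩ :=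
      hw.exists_norm_truncationError_le hopen hD hρ hα.2 hT hf1 hw1 zero_le_two hM0 hwM
    refine ⟨B + K * T ^ (1 - α) + 1, by positivity, fun τ hτ => (h τ hτ).trans ?_⟩
    have hτ2 : τ ^ (2 + (1 - α)) ≤ T ^ (1 - α) * τ ^ 2 := by
      have := rpow_add_le_mul_rpow (s := 2) hτ (sub_pos.2 hα.2).le
      rwa [add_comm, Real.rpow_two] at this
    nlinarith [mul_le_mul_of_nonneg_left hτ2 hK, sq_nonneg τ]
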